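/- For nonzero real-rooted $f,g\in\mathbb R[x]$ with positive leading coefficients and zeros $\alpha_1\ge\alpha_2\ge\cdots$ and $\beta_1\ge\beta_2\ge\cdots$ respectively (with multiplicity), write $f\ll g$ if $\cdots\le\alpha_2\le\beta_2\le\alpha_1\le\beta_1$ (so that $\deg g\in\{\deg f,\deg f+1\}$). The zero polynomial is regarded as real-rooted, and by convention $f\ll 0$ and $0\ll f$ whenever $f$ is zero or is real-rooted with positive leading coefficient. Let $\mathcal F_n^+$ be the set of sequences $(f_1,\dots,f_n)$ of real-rooted polynomials with nonnegative coefficients such that $f_i\ll f_j$ for all $1\le i<j\le n$. An $m\times n$ matrix $G=(G_{ij}(x))$ over $\mathbb R[x]$ acts by $G\cdot(f_1,\dots,f_n)=(g_1,\dots,g_m)$, $g_k=\sum_{i=1}^n G_{ki}f_i$; it is said to map $\mathcal F_n^+$ to $\mathcal F_m^+$ if $G\cdot F\in\mathcal F_m^+$ for every $F\in\mathcal F_n^+$. **Lemma.** Let $G$ be an $m\times n$ matrix over $\mathbb R[x]$, and suppose that for some rows $k<l$ and columns $i<j$ the $2\times2$ submatrix $\begin{pmatrix}G_{ki}&G_{kj}\\G_{li}&G_{lj}\end{pmatrix}$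 has one of the following forms, where $*$ denotes an arbitrary polynomial and $\circ$ denotes an element of $\{0,1,x\}$ (different occurrences may differ): 1. $\begin{pmatrix}x&*\\1&*\end{pmatrix}$ or $\begin{pmatrix}*&x\\ *&1\end{pmatrix}$; 2. $\begin{pmatrix}1&x\\ *&*\end{pmatrix}$ or $\begin{pmatrix}*&*\\1&x\end{pmatrix}$; 3. $\begin{pmatrix}1&\circ\\ \circ&x\end{pmatrix}$, $\begin{pmatrix}x&\circ\\ \circ&1\end{pmatrix}$ or $\begin{pmatrix}*&x\\1&*\end{pmatrix}$, except for $\begin{pmatrix}1&1\\x&x\end{pmatrix}$ and $\begin{pmatrix}x&1\\x&1\end{pmatrix}$; 4. a matrix with all entries in $\{0,1\}$ and negative determinant; 5. $x$ times a matrix with all entries in $\{0,1\}$ and negative determinant. Then $G$ does not map $\mathcal F_n^+$ to $\mathcal F_m^+$. -/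

import Mathlib

open Polynomial

/-- A real polynomial with positive leading coefficient all of whose zeros are real. -/
def RealRootedPos (f : ℝ[X]) : Prop :=
  f.Splits ∧ 0 < f.leadingCoeff

/-- `Interleaver f g` is the relation `f ≪ g`. For nonzero `f` and `g` it says that both are
real-rooted with positive leading coefficients and that their zeros
`α 0 ≥ α 1 ≥ ⋯` (of `f`) and `β 0 ≥ β 1 ≥ ⋯` (of `g`), listed with multiplicity, satisfy
`⋯ ≤ α 1 ≤ β 1 ≤ α 0 ≤ β 0`; the alternation forces `deg g = deg f` or `deg g = deg f + 1`,
and it makes both lists weakly decreasing. By convention `f ≪ 0` and `0 ≪ f`. -/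
def Interleaver (f g : ℝ[X]) : Prop :=
  (f = 0 ∧ (g = 0 ∨ RealRootedPos g)) ∨
  (g = 0 ∧ (f = 0 ∨ RealRootedPos f)) ∨
  ∃ (n m : ℕ) (α β : ℕ → ℝ) (a b : ℝ), 0 < a ∧ 0 < b ∧
    f = C a * ∏ i ∈ Finset.range n, (X - C (α i)) ∧
    g = C b * ∏ i ∈ Finset.range m, (X - C (β i)) ∧
    (m = n ∨ m = n + 1) ∧
    (∀ i, i < n → α i ≤ β i) ∧
    (∀ i, i + 1 < m → β (i + 1) ≤ α i)

/-- The family `𝓕ₙ` of interlacing sequences of `n` real-rooted polynomials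
(the zero polynomial counts as real-rooted). -/
def InterlacingSeq (n : ℕ) : Set (Fin n → ℝ[X]) :=
  {F | (∀ i, (F i).Splits) ∧ ∀ i j, i < j → Interleaver (F i) (F j)}

/-- The family `𝓕ₙ⁺` of interlacing sequences of polynomials with nonnegative coefficients. -/
def InterlacingSeqNonneg (n : ℕ) : Set (Fin n → ℝ[X]) :=
  {F | F ∈ InterlacingSeq n ∧ ∀ i d, 0 ≤ (F i).coeff d}

/-- `G : 𝓕ₙ⁺ → 𝓕ₘ⁺`, where `G` acts on sequences by matrix-vector multiplication. -/
def PreservesInterlacing {m n : ℕ} (G : Matrix (Fin m) (Fin n) ℝ[X]) : Prop :=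
  Set.MapsTo (fun F => G.mulVec F) (InterlacingSeqNonneg n) (InterlacingSeqNonneg m)

/-- Membership in `{0, 1, x}`. -/
def IsZeroOneX (p : ℝ[X]) : Prop :=
  p = 0 ∨ p = 1 ∨ p = X

/-- A real `2 × 2` matrix with entries in `{0, 1}` and negative determinant. -/
def IsZeroOneNegDet (B : Matrix (Fin 2) (Fin 2) ℝ) : Prop :=
  (∀ r s, B r s = 0 ∨ B r s = 1) ∧ B.det < 0

/-- The first kind of forbidden shape: a column equal to `(x, 1)ᵀ`. -/
def ForbiddenI (A : Matrix (Fin 2) (Fin 2) ℝ[X]) : Prop :=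
  (∃ b d : ℝ[X], A = !![X, b; 1, d]) ∨ (∃ a c : ℝ[X], A = !![a, X; c, 1])

/-- The second kind of forbidden shape: a row equal to `(1, x)`. -/
def ForbiddenII (A : Matrix (Fin 2) (Fin 2) ℝ[X]) : Prop :=
  (∃ c d : ℝ[X], A = !![1, X; c, d]) ∨ (∃ a b : ℝ[X], A = !![a, b; 1, X])

/-- The third kind of forbidden shape: `1` and `x` on a diagonal, placed in one of three ways,
with two exceptions. In the first two placements the free entries are `0`, `1` or `x`. -/
def ForbiddenIII (A : Matrix (Fin 2) (Fin 2) ℝ[X]) : Prop :=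
  ((∃ b c : ℝ[X], IsZeroOneX b ∧ IsZeroOneX c ∧ A = !![1, b; c, X]) ∨
    (∃ b c : ℝ[X], IsZeroOneX b ∧ IsZeroOneX c ∧ A = !![X, b; c, 1]) ∨
    (∃ a d : ℝ[X], A = !![a, X; 1, d])) ∧
  A ≠ !![1, 1; X, X] ∧ A ≠ !![X, 1; X, 1]

/-- The fourth kind of forbidden shape: a zero-one matrix with negative determinant. -/
def ForbiddenIV (A : Matrix (Fin 2) (Fin 2) ℝ[X]) : Prop :=
  ∃ B : Matrix (Fin 2) (Fin 2) ℝ, IsZeroOneNegDet B ∧ A = B.map C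

/-- The fifth kind of forbidden shape: `x` times a zero-one matrix with negative determinant. -/
def ForbiddenV (A : Matrix (Fin 2) (Fin 2) ℝ[X]) : Prop :=
  ∃ B : Matrix (Fin 2) (Fin 2) ℝ, IsZeroOneNegDet B ∧ A = (X : ℝ[X]) • B.map C

/-! Since zero is compatible with every member of a sequence, an interlacing pair padded with zeros
stays interlacing. Hence a preserving `G` has preserving order-respecting 2 × 2 submatrices
(`PreservesInterlacing.submatrix`). Each forbidden shape is then refuted on a pair among (1,0),
(0,1), (1,1), (1,x), (1,x+1): the image has a nonreal zero, a wrong degree gap, or a zero with no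
partner on the required side. -/

theorem RealRootedPos.of_coeff_nonneg {f : ℝ[X]} (hs : f.Splits) (hf : ∀ d, 0 ≤ f.coeff d)
    (h0 : f ≠ 0) : RealRootedPos f :=
  ⟨hs, lt_of_le_of_ne (hf _) (leadingCoeff_ne_zero.mpr h0).symm⟩

theorem Interleaver.zero_left {f : ℝ[X]} (h : f = 0 ∨ RealRootedPos f) : Interleaver 0 f :=
  Or.inl ⟨rfl, h⟩

theorem Interleaver.zero_right {f : ℝ[X]} (h : f = 0 ∨ RealRootedPos f) : Interleaver f 0 :=
  Or.inr (Or.inl ⟨rfl, h⟩)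

theorem interleaver_one_one : Interleaver 1 1 :=
  Or.inr (Or.inr ⟨0, 0, 0, 0, 1, 1, by simp⟩)

theorem interleaver_one_X_add_C (c : ℝ) : Interleaver 1 (X + C c) :=
  Or.inr (Or.inr ⟨0, 1, 0, fun _ => -c, 1, 1, by simp⟩)

/-! ### Necessary conditions on degrees and zeros -/

theorem natDegree_C_mul_prod_X_sub_C {a : ℝ} (ha : 0 < a) (n : ℕ) (α : ℕ → ℝ) :
    (C a * ∏ i ∈ Finset.range n, (X - C (α i))).natDegree = n := by
  rw [natDegree_C_mul ha.ne', natDegree_prod_of_monic _ _ fun i _ => monic_X_sub_C _]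
  simp

theorem eval_C_mul_prod_X_sub_C_eq_zero {a : ℝ} (ha : 0 < a) (n : ℕ) (α : ℕ → ℝ) (r : ℝ) :
    (C a * ∏ i ∈ Finset.range n, (X - C (α i))).eval r = 0 ↔ ∃ i < n, α i = r := by
  simp only [eval_mul, eval_C, eval_prod, eval_sub, eval_X, mul_eq_zero, ha.ne', false_or,
    Finset.prod_eq_zero_iff, Finset.mem_range, sub_eq_zero, eq_comm (a := r)]

/-- Degrees of nonzero interlacing polynomials. -/
theorem Interleaver.natDegree_eq {f g : ℝ[X]} (h : Interleaver f g) (hf : f ≠ 0) (hg : g ≠ 0) :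
    g.natDegree = f.natDegree ∨ g.natDegree = f.natDegree + 1 := by
  rcases h with h | h | ⟨n, m, α, β, a, b, ha, hb, rfl, rfl, hmn, -⟩
  · exact absurd h.1 hf
  · exact absurd h.1 hg
  · rwa [natDegree_C_mul_prod_X_sub_C ha, natDegree_C_mul_prod_X_sub_C hb]

/-- Every zero of `f` has a zero of `g` weakly to its right. -/
theorem Interleaver.exists_root_ge {f g : ℝ[X]} (h : Interleaver f g) (hf : f ≠ 0) (hg : g ≠ 0)
    {r : ℝ} (hr : f.eval r = 0) : ∃ s, r ≤ s ∧ g.eval s = 0 := by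
  rcases h with h | h | ⟨n, m, α, β, a, b, ha, hb, rfl, rfl, hmn, h1, -⟩
  · exact absurd h.1 hf
  · exact absurd h.1 hg
  · obtain ⟨i, hi, rfl⟩ := (eval_C_mul_prod_X_sub_C_eq_zero ha n α r).mp hr
    exact ⟨β i, h1 i hi,
      (eval_C_mul_prod_X_sub_C_eq_zero hb m β _).mpr ⟨i, by omega, rfl⟩⟩

/-- In equal degrees, every zero of `g` has a zero of `f` weakly to its left. -/
theorem Interleaver.exists_root_le {f g : ℝ[X]} (h : Interleaver f g) (hf : f ≠ 0) (hg : g ≠ 0)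
    (hd : g.natDegree = f.natDegree) {r : ℝ} (hr : g.eval r = 0) :
    ∃ s, s ≤ r ∧ f.eval s = 0 := by
  rcases h with h | h | ⟨n, m, α, β, a, b, ha, hb, rfl, rfl, -, h1, -⟩
  · exact absurd h.1 hf
  · exact absurd h.1 hg
  · rw [natDegree_C_mul_prod_X_sub_C ha, natDegree_C_mul_prod_X_sub_C hb] at hd
    obtain ⟨i, hi, rfl⟩ := (eval_C_mul_prod_X_sub_C_eq_zero hb m β r).mp hr
    exact ⟨α i, h1 i (by omega),
      (eval_C_mul_prod_X_sub_C_eq_zero ha n α _).mpr ⟨i, by omega, rfl⟩⟩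

/-- If the degree of `g` exceeds that of `f`, every zero of `f` has a zero of `g` weakly to its
left. -/
theorem Interleaver.exists_root_le_of_natDegree_succ {f g : ℝ[X]} (h : Interleaver f g)
    (hf : f ≠ 0) (hg : g ≠ 0) (hd : g.natDegree = f.natDegree + 1) {r : ℝ}
    (hr : f.eval r = 0) : ∃ s, s ≤ r ∧ g.eval s = 0 := by
  rcases h with h | h | ⟨n, m, α, β, a, b, ha, hb, rfl, rfl, -, -, h2⟩
  · exact absurd h.1 hf
  · exact absurd h.1 hg
  · rw [natDegree_C_mul_prod_X_sub_C ha, natDegree_C_mul_prod_X_sub_C hb] at hd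
    obtain ⟨i, hi, rfl⟩ := (eval_C_mul_prod_X_sub_C_eq_zero ha n α r).mp hr
    exact ⟨β (i + 1), h2 i (by omega),
      (eval_C_mul_prod_X_sub_C_eq_zero hb m β _).mpr ⟨i + 1, by omega, rfl⟩⟩

/-! ### Test pairs and reduction to 2 × 2 matrices -/

theorem InterlacingSeqNonneg.pair {f g : ℝ[X]} (hf : f.Splits) (hg : g.Splits)
    (hfg : Interleaver f g) (hf0 : ∀ d, 0 ≤ f.coeff d) (hg0 : ∀ d, 0 ≤ g.coeff d) :
    ![f, g] ∈ InterlacingSeqNonneg 2 := by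
  refine ⟨⟨fun i => ?_, fun i j hij => ?_⟩, fun i => ?_⟩
  · fin_cases i <;> assumption
  · fin_cases i <;> fin_cases j <;> first | exact hfg | exact absurd hij (by decide)
  · fin_cases i <;> assumption

theorem one_coeff_nonneg (d : ℕ) : 0 ≤ (1 : ℝ[X]).coeff d := by
  rw [coeff_one]; split_ifs <;> norm_num

theorem pair_one_zero_mem : ![(1 : ℝ[X]), 0] ∈ InterlacingSeqNonneg 2 :=
  .pair .one .zero (.zero_right (.inr (.of_coeff_nonneg .one one_coeff_nonneg one_ne_zero)))
    one_coeff_nonneg (by simp)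

theorem pair_zero_one_mem : ![(0 : ℝ[X]), 1] ∈ InterlacingSeqNonneg 2 :=
  .pair .zero .one (.zero_left (.inr (.of_coeff_nonneg .one one_coeff_nonneg one_ne_zero)))
    (by simp) one_coeff_nonneg

theorem pair_one_one_mem : ![(1 : ℝ[X]), 1] ∈ InterlacingSeqNonneg 2 :=
  .pair .one .one interleaver_one_one one_coeff_nonneg one_coeff_nonneg

theorem pair_one_X_add_C_mem {c : ℝ} (hc : 0 ≤ c) :
    ![(1 : ℝ[X]), X + C c] ∈ InterlacingSeqNonneg 2 := by
  refine .pair .one (.X_add_C c) (interleaver_one_X_add_C c) one_coeff_nonneg fun d => ?_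
  rw [coeff_add, coeff_X, coeff_C]
  split_ifs <;> linarith

/-- An interlacing pair, placed at positions `i < j` and padded with zeros, is interlacing. -/
theorem InterlacingSeqNonneg.pad {n : ℕ} {i j : Fin n} (hij : i < j) {F : Fin 2 → ℝ[X]}
    (hF : F ∈ InterlacingSeqNonneg 2) :
    (Pi.single i (F 0) + Pi.single j (F 1) : Fin n → ℝ[X]) ∈ InterlacingSeqNonneg n := by
  obtain ⟨⟨hs, hI⟩, hc⟩ := hF
  have hpos : ∀ s, F s = 0 ∨ RealRootedPos (F s) := fun s =>
    or_iff_not_imp_left.mpr (.of_coeff_nonneg (hs s) (hc s))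
  have hval : ∀ a : Fin n, (a = i ∧ (Pi.single i (F 0) + Pi.single j (F 1) : Fin n → ℝ[X]) a = F 0) ∨
      (a = j ∧ (Pi.single i (F 0) + Pi.single j (F 1) : Fin n → ℝ[X]) a = F 1) ∨
      (Pi.single i (F 0) + Pi.single j (F 1) : Fin n → ℝ[X]) a = 0 := by
    intro a
    by_cases hi : a = i
    · subst hi; simp [hij.ne]
    · by_cases hj : a = j
      · subst hj; simp [hij.ne']
      · simp [hi, hj]
  refine ⟨⟨fun a => ?_, fun a b hab => ?_⟩, fun a => ?_⟩
  · rcases hval a with ⟨-, h⟩ | ⟨-, h⟩ | h <;> rw [h]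
    exacts [hs 0, hs 1, .zero]
  · rcases hval a with ⟨ha, h⟩ | ⟨ha, h⟩ | h <;> rcases hval b with ⟨hb, h'⟩ | ⟨hb, h'⟩ | h' <;>
      rw [h, h']
    · exact absurd hab (by simp [ha, hb])
    · exact hI 0 1 (by decide)
    · exact .zero_right (hpos 0)
    · exact absurd hab (by simp [ha, hb, hij.le])
    · exact absurd hab (by simp [ha, hb])
    · exact .zero_right (hpos 1)
    · exact .zero_left (hpos 0)
    · exact .zero_left (hpos 1)
    · exact .zero_left (.inl rfl)
  · rcases hval a with ⟨-, h⟩ | ⟨-, h⟩ | h <;> rw [h]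
    exacts [hc 0, hc 1, by simp]

theorem InterlacingSeqNonneg.comp {m : ℕ} {k l : Fin m} (hkl : k < l) {F : Fin m → ℝ[X]}
    (hF : F ∈ InterlacingSeqNonneg m) : ![F k, F l] ∈ InterlacingSeqNonneg 2 :=
  .pair (hF.1.1 k) (hF.1.1 l) (hF.1.2 k l hkl) (hF.2 k) (hF.2 l)

/-- Preservation of interlacing passes to order-preserving `2 × 2` submatrices. -/
theorem PreservesInterlacing.submatrix {m n : ℕ} {G : Matrix (Fin m) (Fin n) ℝ[X]}
    (hG : PreservesInterlacing G) {k l : Fin m} {i j : Fin n} (hkl : k < l) (hij : i < j) :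
    PreservesInterlacing (G.submatrix ![k, l] ![i, j]) := by
  intro F hF
  have h := InterlacingSeqNonneg.comp hkl (hG (InterlacingSeqNonneg.pad hij hF))
  convert h using 1
  funext s
  fin_cases s <;>
    simp [Matrix.mulVec, dotProduct, Fin.sum_univ_two, mul_add, Finset.sum_add_distrib,
      Pi.single_apply]

section TwoByTwo

variable {a b c d f g : ℝ[X]}

theorem PreservesInterlacing.pair_mem (hA : PreservesInterlacing !![a, b; c, d])
    (hF : ![f, g] ∈ InterlacingSeqNonneg 2) :
    ![a * f + b * g, c * f + d * g] ∈ InterlacingSeqNonneg 2 := by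
  convert hA hF using 1
  funext s
  fin_cases s <;> simp [Matrix.mulVec, dotProduct, Fin.sum_univ_two]

theorem PreservesInterlacing.interleaver (hA : PreservesInterlacing !![a, b; c, d])
    (hF : ![f, g] ∈ InterlacingSeqNonneg 2) :
    Interleaver (a * f + b * g) (c * f + d * g) :=
  (hA.pair_mem hF).1.2 0 1 (by decide)

theorem PreservesInterlacing.splits_fst (hA : PreservesInterlacing !![a, b; c, d])
    (hF : ![f, g] ∈ InterlacingSeqNonneg 2) : (a * f + b * g).Splits :=
  (hA.pair_mem hF).1.1 0

theorem PreservesInterlacing.splits_snd (hA : PreservesInterlacing !![a, b; c, d])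
    (hF : ![f, g] ∈ InterlacingSeqNonneg 2) : (c * f + d * g).Splits :=
  (hA.pair_mem hF).1.1 1

end TwoByTwo

/-! ### Obstructions -/

theorem not_interleaver_of_natDegree_lt {f g : ℝ[X]} (hg : g ≠ 0)
    (hd : g.natDegree < f.natDegree) : ¬ Interleaver f g := fun h => by
  have := h.natDegree_eq (by rintro rfl; simp at hd) hg
  omega

theorem not_interleaver_of_natDegree_add_one_lt {f g : ℝ[X]} (hf : f ≠ 0)
    (hd : f.natDegree + 1 < g.natDegree) : ¬ Interleaver f g := fun h => by
  have := h.natDegree_eq hf (by rintro rfl; simp at hd)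
  omega

/-- A nonconstant polynomial without real zeros does not split over `ℝ`. -/
theorem not_splits_of_eval_ne_zero {f : ℝ[X]} (hd : f.natDegree ≠ 0)
    (h : ∀ x, f.eval x ≠ 0) : ¬ f.Splits := fun hs => by
  obtain ⟨x, hx⟩ := hs.exists_eval_eq_zero (by
    rintro h0
    exact hd (natDegree_eq_of_degree_eq_some h0))
  exact h x hx

theorem not_interleaver_X_one : ¬ Interleaver X 1 :=
  not_interleaver_of_natDegree_lt one_ne_zero (by simp)

/-- The zero 0 would need a zero to its right, but the only candidate is -1. -/
theorem not_interleaver_X_X_add_one : ¬ Interleaver X (X + 1) := fun h => by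
  have h1 : (X + 1 : ℝ[X]) ≠ 0 := (monic_X_add_C 1).ne_zero
  obtain ⟨s, hs, hs'⟩ := h.exists_root_ge X_ne_zero h1 (r := 0) (by simp)
  simp at hs'
  linarith

theorem not_splits_one_add_X_mul : ¬ (1 + X * (X + 1) : ℝ[X]).Splits := by
  refine not_splits_of_eval_ne_zero ?_ fun x => ?_
  · have : (1 + X * (X + 1) : ℝ[X]).natDegree = 2 := by compute_degree!
    omega
  · simp only [eval_add, eval_one, eval_mul, eval_X]
    nlinarith [sq_nonneg (x + 1 / 2)]

/-! ### The five forbidden shapes -/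

theorem ForbiddenI.not_preserves {A : Matrix (Fin 2) (Fin 2) ℝ[X]} (h : ForbiddenI A) :
    ¬ PreservesInterlacing A := by
  intro hA
  rcases h with ⟨b, d, rfl⟩ | ⟨a, c, rfl⟩
  · exact not_interleaver_X_one (by simpa using hA.interleaver pair_one_zero_mem)
  · exact not_interleaver_X_one (by simpa using hA.interleaver pair_zero_one_mem)

theorem ForbiddenII.not_preserves {A : Matrix (Fin 2) (Fin 2) ℝ[X]} (h : ForbiddenII A) :
    ¬ PreservesInterlacing A := by
  intro hA
  rcases h with ⟨c, d, rfl⟩ | ⟨a, b, rfl⟩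
  · exact not_splits_one_add_X_mul
      (by simpa using hA.splits_fst (pair_one_X_add_C_mem zero_le_one))
  · exact not_splits_one_add_X_mul
      (by simpa using hA.splits_snd (pair_one_X_add_C_mem zero_le_one))

/-- The antidiagonal placement of `x` and `1`. -/
theorem not_preserves_X_one_antidiag (a d : ℝ[X]) :
    ¬ PreservesInterlacing !![a, X; 1, d] := by
  intro hA
  -- The pair (1,0) gives a ≪ 1, so a nonzero a is a constant r > 0; then (1,x) yields r + x², which
  -- has no real zero.
  have ha : a = 0 := by
    by_contra ha
    have h1 : Interleaver a 1 := by simpa using hA.interleaver pair_one_zero_mem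
    have hdeg := h1.natDegree_eq ha one_ne_zero
    rw [natDegree_one] at hdeg
    obtain ⟨r, rfl⟩ := natDegree_eq_zero.mp (show a.natDegree = 0 by omega)
    have hr0 : 0 ≤ r := by
      simpa using (hA.pair_mem pair_one_zero_mem).2 0 0
    have hr : 0 < r := lt_of_le_of_ne hr0 (by rintro rfl; simp at ha)
    refine not_splits_of_eval_ne_zero ?_ (fun x => ?_)
      (hA.splits_fst (pair_one_X_add_C_mem le_rfl))
    · have : (C r * 1 + X * (X + C 0) : ℝ[X]).natDegree = 2 := by compute_degree!
      omega
    · simp only [eval_add, eval_one, eval_mul, eval_X, eval_C]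
      nlinarith [sq_nonneg x]
  subst ha
  have hd0 : ∀ e, 0 ≤ d.coeff e := by
    simpa using (hA.pair_mem pair_zero_one_mem).2 1
  -- The pair (1,1) gives x ≪ 1 + d, which demands a zero of 1 + d in [0, ∞).
  have hpos : ∀ s : ℝ, 0 ≤ s → (1 + d).eval s ≠ 0 := by
    intro s hs
    have : 0 ≤ d.eval s := by
      rw [eval_eq_sum]
      exact Finset.sum_nonneg fun e _ => mul_nonneg (hd0 e) (pow_nonneg hs e)
    rw [eval_add, eval_one]
    positivity
  have hI : Interleaver X (1 + d) := by simpa using hA.interleaver pair_one_one_mem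
  obtain ⟨s, hs, hs'⟩ := hI.exists_root_ge X_ne_zero
    (fun h0 => hpos 0 le_rfl (by simp [h0])) (r := 0) (by simp)
  exact hpos s hs hs'

theorem ForbiddenIII.not_preserves {A : Matrix (Fin 2) (Fin 2) ℝ[X]} (h : ForbiddenIII A) :
    ¬ PreservesInterlacing A := by
  obtain ⟨h, hne1, hne2⟩ := h
  rcases h with ⟨b, c, hb, hc, rfl⟩ | ⟨b, c, hb, hc, rfl⟩ | ⟨a, d, rfl⟩
  -- Either of b = x, c = 1 creates a row (1,x). What survives, apart from the exception, fails on
  -- (1,x+1).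
  · by_cases hbX : b = X
    · subst hbX; exact ForbiddenII.not_preserves (.inl ⟨_, _, rfl⟩)
    by_cases hc1 : c = 1
    · subst hc1; exact ForbiddenII.not_preserves (.inr ⟨_, _, rfl⟩)
    intro hA
    have hI := hA.interleaver (pair_one_X_add_C_mem zero_le_one)
    rcases hb with rfl | rfl | rfl
    · refine not_interleaver_of_natDegree_add_one_lt ?_ ?_ hI
      · simp
      · rcases hc with rfl | rfl | rfl
        · have : (0 * 1 + X * (X + C 1) : ℝ[X]).natDegree = 2 := by compute_degree!
          rw [this]; simp
        · exact absurd rfl hc1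
        · have : (X * 1 + X * (X + C 1) : ℝ[X]).natDegree = 2 := by compute_degree!
          rw [this]; simp
    · rcases hc with rfl | rfl | rfl
      · have h1 : (1 * 1 + 1 * (X + C 1) : ℝ[X]).natDegree = 1 := by compute_degree!
        have h2 : (0 * 1 + X * (X + C 1) : ℝ[X]).natDegree = 2 := by compute_degree!
        -- Here x + 2 ≪ x² + x, whose zeros -1 and 0 both exceed -2.
        obtain ⟨s, hs, hs'⟩ := hI.exists_root_le_of_natDegree_succ
          (ne_zero_of_natDegree_gt (n := 0) (by omega))
          (ne_zero_of_natDegree_gt (n := 0) (by omega)) (by omega) (r := -2) (by norm_num)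
        simp only [eval_add, eval_mul, eval_one, eval_X, eval_C, eval_zero] at hs'
        nlinarith
      · exact absurd rfl hc1
      · exact hne1 rfl
    · exact hbX rfl
  · by_cases hbX : b = X
    · subst hbX; exact ForbiddenI.not_preserves (.inr ⟨_, _, rfl⟩)
    by_cases hc1 : c = 1
    · subst hc1; exact ForbiddenI.not_preserves (.inl ⟨_, _, rfl⟩)
    intro hA
    -- The surviving images are x ≪ 1, x ≪ x + 1 and x + 1 ≪ 1.
    have hI := hA.interleaver pair_one_one_mem
    rcases hb with rfl | rfl | rfl
    · rcases hc with rfl | rfl | rfl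
      · exact not_interleaver_X_one (by simpa using hI)
      · exact hc1 rfl
      · exact not_interleaver_X_X_add_one (by simpa using hI)
    · rcases hc with rfl | rfl | rfl
      · refine not_interleaver_of_natDegree_lt ?_ ?_ hI
        · simp
        · have : (X * 1 + 1 * 1 : ℝ[X]).natDegree = 1 := by compute_degree!
          rw [this]; simp
      · exact hc1 rfl
      · exact hne2 rfl
    · exact hbX rfl
  · exact not_preserves_X_one_antidiag a d

/-- The zero-one matrices with negative determinant. -/
theorem IsZeroOneNegDet.eq {B : Matrix (Fin 2) (Fin 2) ℝ} (h : IsZeroOneNegDet B) :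
    B = !![0, 1; 1, 0] ∨ B = !![1, 1; 1, 0] ∨ B = !![0, 1; 1, 1] := by
  obtain ⟨h01, hdet⟩ := h
  rw [Matrix.det_fin_two] at hdet
  rw [Matrix.eta_fin_two B]
  rcases h01 0 0 with h1 | h1 <;> rcases h01 0 1 with h2 | h2 <;>
    rcases h01 1 0 with h3 | h3 <;> rcases h01 1 1 with h4 | h4 <;>
    simp only [h1, h2, h3, h4] at hdet ⊢ <;> norm_num at hdet <;> simp

theorem ForbiddenIV.not_preserves {A : Matrix (Fin 2) (Fin 2) ℝ[X]} (h : ForbiddenIV A) :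
    ¬ PreservesInterlacing A := by
  obtain ⟨B, hB, rfl⟩ := h
  intro hA
  rw [Matrix.eta_fin_two (B.map C)] at hA
  have hI := hA.interleaver (pair_one_X_add_C_mem le_rfl)
  rcases hB.eq with rfl | rfl | rfl
  · exact not_interleaver_X_one (by simpa using hI)
  · have hI' : Interleaver (1 + X) 1 := by simpa using hI
    refine not_interleaver_of_natDegree_lt one_ne_zero ?_ hI'
    have : (1 + X : ℝ[X]).natDegree = 1 := by compute_degree!
    simp [this]
  · exact not_interleaver_X_X_add_one (by simpa [add_comm] using hI)

theorem ForbiddenV.not_preserves {A : Matrix (Fin 2) (Fin 2) ℝ[X]} (h : ForbiddenV A) :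
    ¬ PreservesInterlacing A := by
  obtain ⟨B, hB, rfl⟩ := h
  intro hA
  rw [Matrix.eta_fin_two ((X : ℝ[X]) • B.map C)] at hA
  have hI := hA.interleaver (pair_one_X_add_C_mem le_rfl)
  rcases hB.eq with rfl | rfl | rfl
  · have hI' : Interleaver (X * X) X := by simpa using hI
    exact not_interleaver_of_natDegree_lt X_ne_zero (by simp) hI'
  · have hI' : Interleaver (X + X * X) X := by simpa using hI
    refine not_interleaver_of_natDegree_lt X_ne_zero ?_ hI'
    have : (X + X * X : ℝ[X]).natDegree = 2 := by compute_degree!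
    simp [this]
  · have hI' : Interleaver (X * X) (X + X * X) := by simpa using hI
    have h1 : (X * X : ℝ[X]).natDegree = 2 := by compute_degree!
    have h2 : (X + X * X : ℝ[X]).natDegree = 2 := by compute_degree!
    -- The common factor x puts 0 among the zeros of both sides, so looking right from 0 detects
    -- nothing; instead -1 has no zero of x² to its left.
    obtain ⟨s, hs, hs'⟩ := hI'.exists_root_le
      (ne_zero_of_natDegree_gt (n := 0) (by omega))
      (ne_zero_of_natDegree_gt (n := 0) (by omega)) (by omega) (r := -1) (by norm_num)
    simp only [eval_mul, eval_X] at hs'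
    nlinarith

theorem lemma3p3 {m n : ℕ} (G : Matrix (Fin m) (Fin n) ℝ[X])
    (k l : Fin m) (i j : Fin n) (hkl : k < l) (hij : i < j)
    (h : ForbiddenI (G.submatrix ![k, l] ![i, j]) ∨
      ForbiddenII (G.submatrix ![k, l] ![i, j]) ∨
      ForbiddenIII (G.submatrix ![k, l] ![i, j]) ∨
      ForbiddenIV (G.submatrix ![k, l] ![i, j]) ∨
      ForbiddenV (G.submatrix ![k, l] ![i, j])) :
    ¬ PreservesInterlacing G := by
  intro hG
  have hA := hG.submatrix hkl hij
  rcases h with h | h | h | h | h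
  · exact h.not_preserves hA
  · exact h.not_preserves hA
  · exact h.not_preserves hA
  · exact h.not_preserves hA
  · exact h.not_preserves hA
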